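/- Let $\Omega \subsetneq \mathbb{C}$ be a simply connected domain and let $\sigma : \Omega \to \Omega$ be an antiholomorphic involution. Let $H^\infty(\Omega)$ be the Banach algebra of bounded holomorphic functions on $\Omega$ with the supremum norm, made into a Banach $*$-algebra by the involution $f^\sharp(z) := \overline{f(\sigma(z))}$. Let $H^\infty(\Omega)_* \subseteq H^\infty(\Omega)^*$ be the predual of $H^\infty(\Omega)$, i.e. the norm-closed subspace of the dual for which the canonical map $H^\infty(\Omega) \to (H^\infty(\Omega)_*)^*$, $f \mapsto (\varphi \mapsto \varphi(f))$, is an isometric isomorphism (by Ando's theorem it is unique), and call the initial topology on $H^\infty(\Omega)$ defined by the functionals in $H^\infty(\Omega)_*$ the weak topology. Let $\pi : (H^\infty(\Omega), \sharp) \to B(\mathcal{H})$ be a $*$-representation by bounded operators on a complex Hilbert space $\mathcal{H}$ (a $*$-homomorphism of complex algebras, not assumed to be unital or continuous). Then the following are equivalent: (a) For every trace class operator $A$ on $\mathcal{H}$, the functional $f \mapsto \operatorname{tr}(A\pi(f))$ is weakly continuous on $H^\infty(\Omega)$. (b) For every $\xi \in \mathcal{H}$, the matrix coefficient $f \mapsto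 \langle \xi, \pi(f)\xi\rangle$ is weakly continuous on $H^\infty(\Omega)$. (c) There exists a dense linear subspace $\mathcal{D} \subseteq \mathcal{H}$ such that, for every $\xi \in \mathcal{D}$, the matrix coefficient $f \mapsto \langle \xi, \pi(f)\xi\rangle$ is weakly continuous on $H^\infty(\Omega)$. -/

import Mathlib

noncomputable section

open scoped BoundedContinuousFunction ComplexConjugate InnerProductSpace

/-! ### Bounded holomorphic functions on a domain -/

/-- A function on the open set `Ω` is holomorphic if it is the restriction of a function on `ℂ`
which is complex differentiable at all points of `Ω`. -/
def HolomorphicOnOpens (Ω : TopologicalSpace.Opens ℂ) (f : Ω → ℂ) : Prop :=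
  ∃ g : ℂ → ℂ, DifferentiableOn ℂ g (Ω : Set ℂ) ∧ ∀ z : Ω, g z = f z

/-- An antiholomorphic involution of `Ω`. -/
structure AntiholomorphicInvolution (Ω : TopologicalSpace.Opens ℂ) where
  /-- the underlying map -/
  toFun : Ω → Ω
  involutive : Function.Involutive toFun
  antiholomorphic : HolomorphicOnOpens Ω (fun z => conj ((toFun z : Ω) : ℂ))

/-- The algebra of bounded holomorphic functions on `Ω`, as a subalgebra of the Banach algebra of
bounded continuous functions with the supremum norm. -/
def boundedHolomorphic (Ω : TopologicalSpace.Opens ℂ) : Subalgebra ℂ (Ω →ᵇ ℂ) where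
  carrier := {f | HolomorphicOnOpens Ω f}
  mul_mem' := by
    rintro a b ⟨g, hg, hga⟩ ⟨h, hh, hhb⟩
    exact ⟨g * h, hg.mul hh, fun z => by simp [hga, hhb]⟩
  add_mem' := by
    rintro a b ⟨g, hg, hga⟩ ⟨h, hh, hhb⟩
    exact ⟨g + h, hg.add hh, fun z => by simp [hga, hhb]⟩
  algebraMap_mem' r := ⟨fun _ => r, differentiableOn_const r, fun z => by
    simp [BoundedContinuousFunction.algebraMap_apply]⟩

/-- The Banach `*`-algebra `(H^∞(Ω), ♯)`: bounded holomorphic functions on `Ω` with the supremum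
norm and the involution `f♯(z) = conj (f (σ z))`.  The involution of `Ω` is recorded in the type,
so that the `*`-structure can be an instance. -/
def HInfty {Ω : TopologicalSpace.Opens ℂ} (_σ : AntiholomorphicInvolution Ω) : Type :=
  boundedHolomorphic Ω

namespace HInfty

variable {Ω : TopologicalSpace.Opens ℂ} {σ : AntiholomorphicInvolution Ω}

instance : NormedCommRing (HInfty σ) :=
  inferInstanceAs (NormedCommRing (boundedHolomorphic Ω))

instance : NormedAlgebra ℂ (HInfty σ) :=
  inferInstanceAs (NormedAlgebra ℂ (boundedHolomorphic Ω))

/-- The underlying bounded continuous function. -/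
def toBCF (f : HInfty σ) : Ω →ᵇ ℂ :=
  (boundedHolomorphic Ω).val f

instance : FunLike (HInfty σ) Ω ℂ where
  coe f := toBCF f
  coe_injective _ _ h := Subtype.ext (DFunLike.coe_injective h)

theorem ext {f g : HInfty σ} (h : ∀ z, f z = g z) : f = g := DFunLike.ext f g h

theorem holomorphic (f : HInfty σ) : HolomorphicOnOpens Ω f := f.2

@[simp] theorem add_apply (f g : HInfty σ) (z : Ω) : (f + g) z = f z + g z := rfl

@[simp] theorem mul_apply (f g : HInfty σ) (z : Ω) : (f * g) z = f z * g z := rfl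

@[simp] theorem smul_apply (c : ℂ) (f : HInfty σ) (z : Ω) : (c • f) z = c * f z := rfl

theorem norm_apply_le (f : HInfty σ) (z : Ω) : ‖f z‖ ≤ ‖f‖ :=
  BoundedContinuousFunction.norm_coe_le_norm (toBCF f) z

theorem norm_le (f : HInfty σ) {C : ℝ} (hC : 0 ≤ C) (h : ∀ z, ‖f z‖ ≤ C) : ‖f‖ ≤ C :=
  (BoundedContinuousFunction.norm_le hC).2 h

/-- A bounded holomorphic function, as an element of `H^∞(Ω)`. -/
def mk (f : Ω → ℂ) (hf : HolomorphicOnOpens Ω f) (C : ℝ) (hC : ∀ z, ‖f z‖ ≤ C) : HInfty σ :=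
  ⟨BoundedContinuousFunction.ofNormedAddCommGroup f
    (by
      obtain ⟨g, hg, hgf⟩ := hf
      have : f = (Ω : Set ℂ).domRestrict g := funext fun z => (hgf z).symm
      rw [this]
      exact hg.continuousOn.domRestrict) C hC, hf⟩

@[simp] theorem mk_apply (f : Ω → ℂ) (hf : HolomorphicOnOpens Ω f) (C : ℝ)
    (hC : ∀ z, ‖f z‖ ≤ C) (z : Ω) : (mk f hf C hC : HInfty σ) z = f z := rfl

theorem holomorphic_sharp (f : HInfty σ) :
    HolomorphicOnOpens Ω (fun z => conj (f (σ.toFun z))) := by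
  obtain ⟨g, hg, hgf⟩ := f.holomorphic
  obtain ⟨s, hs, hsσ⟩ := σ.antiholomorphic
  have hs' : ∀ z : Ω, conj (s z) = σ.toFun z := fun z => by rw [hsσ, Complex.conj_conj]
  refine ⟨fun z => conj (g (conj (s z))), fun z hz => ?_, fun z => ?_⟩
  · have h1 : DifferentiableAt ℂ g (conj (s z)) := by
      rw [hs' ⟨z, hz⟩]
      exact hg.differentiableAt (Ω.isOpen.mem_nhds (σ.toFun ⟨z, hz⟩).2)
    have h2 := h1.conj_conj
    rw [Complex.conj_conj] at h2
    exact (h2.comp z (hs.differentiableAt (Ω.isOpen.mem_nhds hz))).differentiableWithinAt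
  · change conj (g (conj (s z))) = _
    rw [hs', hgf]

instance : Star (HInfty σ) :=
  ⟨fun f => mk (fun z => conj (f (σ.toFun z))) (holomorphic_sharp f) ‖f‖ fun z => by
    rw [RCLike.norm_conj]
    exact norm_apply_le f _⟩

@[simp] theorem star_apply (f : HInfty σ) (z : Ω) : (star f) z = conj (f (σ.toFun z)) := rfl

instance : StarRing (HInfty σ) where
  star_involutive f := ext fun z => by simp [σ.involutive z]
  star_mul f g := ext fun z => by simp [mul_comm]
  star_add f g := ext fun z => by simp

instance : StarModule ℂ (HInfty σ) where
  star_smul c f := ext fun z => by simp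

instance : NormedStarGroup (HInfty σ) where
  norm_star_le f := norm_le _ (norm_nonneg f) fun z => by
    rw [star_apply, RCLike.norm_conj]
    exact norm_apply_le f _

end HInfty

/-! ### Preduals and the weak topology -/

/-- The dual Banach space of a normed space. -/
abbrev NormedDual (V : Type*) [NormedAddCommGroup V] [NormedSpace ℂ V] : Type _ :=
  StrongDual ℂ V

/-- The canonical contraction `E → F^*`, `x ↦ (φ ↦ φ x)`, for a subspace `F` of the dual. -/
def evalOn {E : Type*} [NormedAddCommGroup E] [NormedSpace ℂ E]
    (F : Submodule ℂ (NormedDual E)) (x : E) : NormedDual F :=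
  (NormedSpace.inclusionInDoubleDual ℂ E x).comp F.subtypeL

@[simp] theorem evalOn_apply {E : Type*} [NormedAddCommGroup E] [NormedSpace ℂ E]
    (F : Submodule ℂ (NormedDual E)) (x : E) (φ : F) : evalOn F x φ = (φ : NormedDual E) x := rfl

/-- A subspace `F ⊆ E^*` is a predual of `E` if it is a Banach space with its norm, i.e. closed
in `E^*`, and the canonical linear map `E → F^*` is an isometric isomorphism. -/
structure IsPredual {E : Type*} [NormedAddCommGroup E] [NormedSpace ℂ E]
    (F : Submodule ℂ (NormedDual E)) : Prop where
  isClosed : IsClosed (F : Set (NormedDual E))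
  norm_evalOn : ∀ x : E, ‖evalOn F x‖ = ‖x‖
  surjective : Function.Surjective (evalOn F)

/-- The initial topology on `E` defined by the functionals in `F`. -/
abbrev weakTopologyOf {E : Type*} [NormedAddCommGroup E] [NormedSpace ℂ E]
    (F : Submodule ℂ (NormedDual E)) : TopologicalSpace E :=
  ⨅ φ : F, TopologicalSpace.induced (fun x => (φ : NormedDual E) x) inferInstance

/-- Continuity of a scalar function on `E` for the weak topology defined by `F`. -/
def WeaklyContinuous {E : Type*} [NormedAddCommGroup E] [NormedSpace ℂ E]
    (F : Submodule ℂ (NormedDual E)) (u : E → ℂ) : Prop :=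
  @Continuous E ℂ (weakTopologyOf F) inferInstance u

/-! ### `H^∞(Ω)` has a predual -/

namespace HInfty

variable {Ω : TopologicalSpace.Opens ℂ} (σ : AntiholomorphicInvolution Ω)

/-- The evaluation functional at a point of `Ω`. -/
def pointEval (z : Ω) : NormedDual (HInfty σ) :=
  LinearMap.mkContinuous
    { toFun := fun f => f z
      map_add' := fun _ _ => rfl
      map_smul' := fun _ _ => rfl } 1 fun f => by
    rw [one_mul]
    exact norm_apply_le f z

@[simp] theorem pointEval_apply (z : Ω) (f : HInfty σ) : pointEval σ z f = f z := rfl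

theorem norm_pointEval_le (z : Ω) : ‖pointEval σ z‖ ≤ 1 :=
  LinearMap.mkContinuous_norm_le _ zero_le_one _

/-- The closed linear span of the point evaluations in the dual of `H^∞(Ω)`. -/
def pointPredual : Submodule ℂ (NormedDual (HInfty σ)) :=
  (Submodule.span ℂ (Set.range (pointEval σ))).topologicalClosure

theorem pointEval_mem (z : Ω) : pointEval σ z ∈ pointPredual σ :=
  Submodule.le_topologicalClosure _ (Submodule.subset_span ⟨z, rfl⟩)

variable {σ} in
/-- The extension by zero. -/
def extend (f : HInfty σ) (z : ℂ) : ℂ :=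
  open Classical in if h : z ∈ Ω then f ⟨z, h⟩ else 0

variable {σ} in
theorem extend_of_mem (f : HInfty σ) {z : ℂ} (h : z ∈ Ω) : f.extend z = f ⟨z, h⟩ := dif_pos h

variable {σ} in
theorem norm_extend_le (f : HInfty σ) (z : ℂ) : ‖f.extend z‖ ≤ ‖f‖ := by
  by_cases h : z ∈ Ω
  · rw [extend_of_mem f h]
    exact norm_apply_le f _
  · simp [extend, h]

variable {σ} in
theorem differentiableOn_extend (f : HInfty σ) : DifferentiableOn ℂ f.extend (Ω : Set ℂ) := by
  obtain ⟨g, hg, hgf⟩ := f.holomorphic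
  exact hg.congr fun z hz => by rw [extend_of_mem f hz, ← hgf ⟨z, hz⟩]

variable {σ} in
theorem mapsTo_extend (f : HInfty σ) (c : ℂ) (R : ℝ) :
    Set.MapsTo f.extend (Metric.ball c R) (Metric.closedBall (f.extend c) (2 * ‖f‖)) :=
  fun w _ => by
    rw [mem_closedBall_iff_norm]
    have := norm_sub_le (f.extend w) (f.extend c)
    linarith [f.norm_extend_le w, f.norm_extend_le c]

variable {σ} in
theorem norm_dslope_extend_le (f : HInfty σ) {c w : ℂ} {R : ℝ} (hc : Metric.ball c R ⊆ Ω)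
    (hw : w ∈ Metric.ball c R) : ‖dslope f.extend c w‖ ≤ 2 * ‖f‖ / R :=
  Complex.norm_dslope_le_div_of_mapsTo_ball (f.differentiableOn_extend.mono hc)
    (f.mapsTo_extend c R) hw

variable {σ} in
/-- The quantitative first order Taylor formula. -/
theorem norm_taylor_le (f : HInfty σ) {c z : ℂ} {R : ℝ} (hR : 0 < R)
    (hc : Metric.ball c R ⊆ Ω) (hz : z ∈ Metric.ball c R) :
    ‖f.extend z - f.extend c - (z - c) * deriv f.extend c‖
      ≤ 4 / R ^ 2 * ‖z - c‖ ^ 2 * ‖f‖ := by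
  set g := dslope f.extend c with hg
  have hgd : DifferentiableOn ℂ g (Metric.ball c R) :=
    (Complex.differentiableOn_dslope (Metric.ball_mem_nhds c hR)).2
      (f.differentiableOn_extend.mono hc)
  have hgmaps : Set.MapsTo g (Metric.ball c R)
      (Metric.closedBall (g c) (4 * ‖f‖ / R)) := fun w hw => by
    rw [mem_closedBall_iff_norm]
    have h1 := norm_sub_le (g w) (g c)
    have h2 : ‖g w‖ ≤ _ := f.norm_dslope_extend_le hc hw
    have h3 : ‖g c‖ ≤ _ := f.norm_dslope_extend_le hc (Metric.mem_ball_self hR)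
    have h4 : 4 * ‖f‖ / R = 2 * ‖f‖ / R + 2 * ‖f‖ / R := by ring
    linarith
  have hdist := Complex.dist_le_div_mul_dist_of_mapsTo_ball hgd hgmaps hz
  rw [dist_eq_norm, dist_eq_norm] at hdist
  have h1 : f.extend z - f.extend c - (z - c) * deriv f.extend c = (z - c) * (g z - g c) := by
    have h2 := sub_smul_dslope f.extend c z
    rw [smul_eq_mul] at h2
    rw [mul_sub, hg, h2, dslope_same]
  rw [h1, norm_mul]
  refine (mul_le_mul_of_nonneg_left hdist (norm_nonneg _)).trans_eq ?_
  field_simp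

/-- A bounded functional on the dual of `H^∞(Ω)` gives a holomorphic function on `Ω`. -/
theorem holomorphic_functional (L : NormedDual (NormedDual (HInfty σ))) :
    HolomorphicOnOpens Ω (fun z => L (pointEval σ z)) := by
  classical
  refine ⟨fun z => if h : z ∈ Ω then L (pointEval σ ⟨z, h⟩) else 0, fun c hc => ?_,
    fun z => by simp⟩
  obtain ⟨R, hR, hRΩ⟩ := Metric.isOpen_iff.1 Ω.isOpen c hc
  have hdiff : ∀ f : HInfty σ, DifferentiableAt ℂ f.extend c := fun f =>
    f.differentiableOn_extend.differentiableAt (Ω.isOpen.mem_nhds hc)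
  have hext : ∀ (f g : HInfty σ), (f + g).extend = f.extend + g.extend := fun f g => by
    funext z
    by_cases h : z ∈ Ω <;> simp [extend, h]
  have hsmul : ∀ (a : ℂ) (f : HInfty σ), (a • f).extend = a • f.extend := fun a f => by
    funext z
    by_cases h : z ∈ Ω <;> simp [extend, h]
  let D : NormedDual (HInfty σ) := LinearMap.mkContinuous
    { toFun := fun f => deriv f.extend c
      map_add' := fun f g => by rw [hext, deriv_add (hdiff f) (hdiff g)]
      map_smul' := fun a f => by
        rw [hsmul, deriv_const_smul _ (hdiff f)]
        rfl } (2 / R) fun f => by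
    have h := f.norm_dslope_extend_le hRΩ (Metric.mem_ball_self hR)
    rw [dslope_same] at h
    exact h.trans_eq (by ring)
  have hD : ∀ f, D f = deriv f.extend c := fun _ => rfl
  refine (HasDerivAt.differentiableAt (f' := L D) ?_).differentiableWithinAt
  rw [hasDerivAt_iff_isLittleO]
  refine Asymptotics.IsBigO.trans_isLittleO (g := fun z => ‖z - c‖ ^ 2) ?_
    (Asymptotics.isLittleO_pow_sub_sub c one_lt_two)
  refine Asymptotics.IsBigO.of_bound (‖L‖ * (4 / R ^ 2)) ?_
  filter_upwards [Metric.ball_mem_nhds c hR] with z hz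
  have hzΩ : z ∈ Ω := hRΩ hz
  have hcΩ : c ∈ Ω := hc
  rw [dif_pos hzΩ, dif_pos hcΩ, ← map_sub, ← map_smul, ← map_sub]
  refine (L.le_opNorm _).trans ?_
  rw [mul_assoc]
  refine mul_le_mul_of_nonneg_left ?_ (norm_nonneg L)
  refine ContinuousLinearMap.opNorm_le_bound _ (by positivity) fun f => ?_
  have h := f.norm_taylor_le hR hRΩ hz
  rw [f.extend_of_mem (hRΩ hz), f.extend_of_mem hc] at h
  refine h.trans_eq ?_
  simp

/-- The closed span of the point evaluations is a predual of `H^∞(Ω)`. -/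
theorem isPredual_pointPredual : IsPredual (pointPredual σ) where
  isClosed := Submodule.isClosed_topologicalClosure _
  norm_evalOn f := by
    refine le_antisymm (ContinuousLinearMap.opNorm_le_bound _ (norm_nonneg f) fun φ => ?_) ?_
    · rw [mul_comm]
      exact (φ : NormedDual (HInfty σ)).le_opNorm f
    · refine norm_le f (norm_nonneg _) fun z => ?_
      have h := (evalOn (pointPredual σ) f).le_opNorm ⟨pointEval σ z, pointEval_mem σ z⟩
      refine h.trans (mul_le_of_le_one_right (norm_nonneg _) ?_)
      exact norm_pointEval_le σ z
  surjective ℓ := by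
    obtain ⟨L, hL, -⟩ := exists_extension_norm_eq (pointPredual σ) ℓ
    have hb : ∀ z, ‖L (pointEval σ z)‖ ≤ ‖L‖ := fun z =>
      (L.le_opNorm _).trans (mul_le_of_le_one_right (norm_nonneg _) (norm_pointEval_le σ z))
    set f : HInfty σ := mk _ (holomorphic_functional σ L) ‖L‖ hb
    have key : ∀ φ ∈ pointPredual σ, φ f = L φ := by
      have hcl : IsClosed {φ : NormedDual (HInfty σ) | φ f = L φ} :=
        isClosed_eq (NormedSpace.inclusionInDoubleDual ℂ _ f).continuous L.continuous
      intro φ hφ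
      refine closure_minimal (fun ψ hψ => ?_) hcl hφ
      induction hψ using Submodule.span_induction with
      | mem x hx =>
        obtain ⟨z, rfl⟩ := hx
        rfl
      | zero => simp
      | add x y _ _ hx hy =>
        simp only [Set.mem_ofPred_eq] at hx hy ⊢
        simp [hx, hy]
      | smul a x _ hx =>
        simp only [Set.mem_ofPred_eq] at hx ⊢
        simp [hx]
    refine ⟨f, ContinuousLinearMap.ext fun φ => ?_⟩
    rw [evalOn_apply, key φ φ.2, hL]

instance : CompleteSpace (HInfty σ) := by
  have hP := isPredual_pointPredual σ
  have hadd : ∀ f g, evalOn (pointPredual σ) (f - g) =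
      evalOn (pointPredual σ) f - evalOn (pointPredual σ) g := fun f g =>
    ContinuousLinearMap.ext fun φ => map_sub (φ : NormedDual (HInfty σ)) f g
  have hiso : Isometry (evalOn (pointPredual σ)) := Isometry.of_dist_eq fun f g => by
    rw [dist_eq_norm, dist_eq_norm, ← hadd, hP.norm_evalOn]
  exact (IsometryEquiv.mk (Equiv.ofBijective _ ⟨hiso.injective, hP.surjective⟩)
    hiso).completeSpace

end HInfty

/-! ### Trace class operators -/

section Trace

variable {H : Type*} [NormedAddCommGroup H] [InnerProductSpace ℂ H] [CompleteSpace H]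

/-- The index set of a Hilbert basis of `H`, chosen once and for all. -/
def hilbertIndex (H : Type*) [NormedAddCommGroup H] [InnerProductSpace ℂ H] [CompleteSpace H] :
    Set H :=
  (exists_hilbertBasis ℂ H).choose

/-- A Hilbert basis of `H`, chosen once and for all. -/
def someHilbertBasis (H : Type*) [NormedAddCommGroup H] [InnerProductSpace ℂ H]
    [CompleteSpace H] : HilbertBasis (hilbertIndex H) ℂ H :=
  (exists_hilbertBasis ℂ H).choose_spec.choose

/-- `A` is of trace class if `∑ ⟨e, |A| e⟩ < ∞` for an orthonormal basis, `|A| = (A^* A)^{1/2}`. -/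
def IsTraceClass (A : H →L[ℂ] H) : Prop :=
  Summable fun i => RCLike.re (inner ℂ (someHilbertBasis H i) (CFC.abs A (someHilbertBasis H i)))

/-- The trace `∑ ⟨e, A e⟩`, over an orthonormal basis, of a trace class operator. -/
def opTrace (A : H →L[ℂ] H) : ℂ :=
  ∑' i, inner ℂ (someHilbertBasis H i) (A (someHilbertBasis H i))

end Trace

end

/-!
The weakly continuous linear functionals on `H^∞(Ω)` are exactly the elements of the predual `F`
(`weaklyContinuous_iff_mem`), and `F` is norm closed in the dual. So every implication asks
whether a certain functional belongs to a norm-closed subspace. The representation is not assumed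
to be continuous, but a `*`-homomorphism from a Banach `*`-algebra to a C⋆-algebra shrinks spectra
and is therefore contractive (`norm_starHom_apply_le`), so all functionals in question are bounded,
with norm controlled by the vectors or operators that define them.

* From a dense set of vectors to all vectors: the matrix coefficient of `ξ` is the norm limit of
  the matrix coefficients of vectors tending to `ξ` (`matrixCoeff_mem_of_dense`).
* From matrix coefficients to trace class operators: let `A = U|A|` be a polar decomposition, and
  `S = |A|^{1/2}`, a Hilbert–Schmidt operator. Then
  `tr (A π(f)) = ∑ᵢ ⟨S U⋆ eᵢ, S π(f) eᵢ⟩ = ∑ᵢ ⟨A⋆ eᵢ, π(f) eᵢ⟩`. Each summand is in `F` by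
  polarization, and the Cauchy–Schwarz inequality for the first form of the summands shows that the
  series converges in the norm of the dual (`trace_functional_mem`).
* From trace class operators to matrix coefficients: take for `A` the rank one operator
  `η ↦ ⟨ξ, η⟩ ξ`.
-/

noncomputable section

open scoped InnerProductSpace ENNReal

/-! ### Weakly continuous functionals -/

theorem weaklyContinuous_iff_mem {E : Type*} [NormedAddCommGroup E] [NormedSpace ℂ E]
    (F : Submodule ℂ (NormedDual E)) (φ : NormedDual E) :
    WeaklyContinuous F φ ↔ φ ∈ F := by
  refine ⟨fun h => ?_, fun h => ?_⟩
  · let f : F → E →ₗ[ℂ] ℂ := fun ψ => ((ψ : NormedDual E) : E →ₗ[ℂ] ℂ)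
    have h1 : (φ : E →ₗ[ℂ] ℂ) ∈ Submodule.span ℂ (Set.range f) :=
      (LinearMap.mem_span_iff_continuous (f := f) (φ : E →ₗ[ℂ] ℂ)).2 h
    have h2 : Submodule.span ℂ (Set.range f) ≤ F.map (ContinuousLinearMap.coeLM ℂ) := by
      rw [Submodule.span_le]
      rintro _ ⟨ψ, rfl⟩
      exact ⟨ψ, ψ.2, rfl⟩
    obtain ⟨ψ, hψ, hψφ⟩ := h2 h1
    rwa [← ContinuousLinearMap.coe_injective hψφ]
  · exact continuous_iInf_dom (i := (⟨φ, h⟩ : F)) continuous_induced_dom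

/-! ### Automatic continuity -/

/-- A `*`-homomorphism, not assumed unital or continuous, from a Banach `*`-algebra to a
C⋆-algebra is contractive: the norm of a self-adjoint element of the C⋆-algebra is its spectral
radius, and the homomorphism shrinks quasispectra. -/
theorem norm_starHom_apply_le {A B : Type*} [NormedRing A] [NormedAlgebra ℂ A] [CompleteSpace A]
    [NormOneClass A] [StarRing A] [NormedStarGroup A] [CStarAlgebra B]
    (φ : A →⋆ₙₐ[ℂ] B) (a : A) : ‖φ a‖ ≤ ‖a‖ := by
  have key : ∀ s : A, IsSelfAdjoint s → ‖φ s‖ ≤ ‖s‖ := fun s hs => by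
    have h : spectralRadius ℂ (φ s) ≤ ‖s‖₊ := by
      refine iSup₂_le fun k hk => ?_
      have h1 : k ∈ quasispectrum ℂ s :=
        NonUnitalAlgHom.quasispectrum_apply_subset φ s (spectrum_subset_quasispectrum ℂ _ hk)
      rw [quasispectrum_eq_spectrum_union_zero] at h1
      rcases h1 with h1 | h1
      · exact_mod_cast spectrum.norm_le_norm_of_mem h1
      · rw [Set.mem_singleton_iff] at h1
        simp [h1]
    rw [(hs.map φ).spectralRadius_eq_nnnorm] at h
    exact_mod_cast h
  refine abs_le_of_sq_le_sq' ?_ (norm_nonneg a) |>.2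
  calc ‖φ a‖ ^ 2 = ‖φ (star a * a)‖ := by
        rw [map_mul, map_star, CStarRing.norm_star_mul_self, sq]
    _ ≤ ‖star a * a‖ := key _ (.star_mul_self a)
    _ ≤ ‖a‖ ^ 2 := by
        rw [sq]
        simpa using norm_mul_le (star a) a

instance {Ω : TopologicalSpace.Opens ℂ} [Nonempty Ω] (σ : AntiholomorphicInvolution Ω) :
    NormOneClass (HInfty σ) :=
  ⟨le_antisymm (HInfty.norm_le _ zero_le_one fun _ => (norm_one (α := ℂ)).le)
    ((norm_one (α := ℂ)).ge.trans (HInfty.norm_apply_le 1 (Classical.arbitrary Ω)))⟩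

/-! ### Hilbert–Schmidt sums -/

section Operators

variable {H : Type*} [NormedAddCommGroup H] [InnerProductSpace ℂ H]

section HilbertSchmidt

variable {ι : Type*} (b : HilbertBasis ι ℂ H)

/-- The square of the Hilbert–Schmidt norm of `T` with respect to a Hilbert basis, with value `∞`
if `T` is not a Hilbert–Schmidt operator. -/
def hilbertSchmidtSq (T : H →L[ℂ] H) : ℝ≥0∞ := ∑' i, ‖T (b i)‖ₑ ^ 2

theorem HilbertBasis.tsum_enorm_inner_sq (x : H) : ∑' i, ‖⟪b i, x⟫_ℂ‖ₑ ^ 2 = ‖x‖ₑ ^ 2 := by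
  have h := b.hasSum_inner_mul_inner x x
  have h1 : HasSum (fun i => ‖⟪b i, x⟫_ℂ‖ ^ 2) (‖x‖ ^ 2) := by
    have h2 := Complex.hasSum_re h
    convert h2 using 1
    · funext i
      rw [← inner_conj_symm x (b i), ← Complex.normSq_eq_conj_mul_self, Complex.ofReal_re,
        Complex.normSq_eq_norm_sq]
    · exact (inner_self_eq_norm_sq (𝕜 := ℂ) x).symm
  have h3 : ∀ y : ℝ, 0 ≤ y → ENNReal.ofReal (y ^ 2) = ENNReal.ofReal y ^ 2 := fun y hy =>
    ENNReal.ofReal_pow hy 2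
  simp_rw [← ofReal_norm, ← h3 _ (norm_nonneg _)]
  rw [← ENNReal.ofReal_tsum_of_nonneg (fun _ => by positivity) h1.summable, h1.tsum_eq]

theorem hilbertSchmidtSq_adjoint [CompleteSpace H] (T : H →L[ℂ] H) :
    hilbertSchmidtSq b (star T) = hilbertSchmidtSq b T := by
  unfold hilbertSchmidtSq
  simp_rw [← b.tsum_enorm_inner_sq]
  rw [ENNReal.tsum_comm]
  refine tsum_congr fun i => tsum_congr fun j => ?_
  rw [ContinuousLinearMap.star_eq_adjoint, ContinuousLinearMap.adjoint_inner_right,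
    ← ofReal_norm, ← ofReal_norm, norm_inner_symm]

theorem hilbertSchmidtSq_mul_le_left (R T : H →L[ℂ] H) :
    hilbertSchmidtSq b (R * T) ≤ ‖R‖ₑ ^ 2 * hilbertSchmidtSq b T := by
  unfold hilbertSchmidtSq
  rw [← ENNReal.tsum_mul_left]
  refine ENNReal.tsum_le_tsum fun i => ?_
  rw [← mul_pow]
  gcongr
  exact R.le_opENorm _

theorem hilbertSchmidtSq_mul_le_right [CompleteSpace H] (T R : H →L[ℂ] H) :
    hilbertSchmidtSq b (T * R) ≤ ‖R‖ₑ ^ 2 * hilbertSchmidtSq b T := by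
  rw [← hilbertSchmidtSq_adjoint b (T * R), star_mul, ← hilbertSchmidtSq_adjoint b T]
  refine (hilbertSchmidtSq_mul_le_left b _ _).trans_eq ?_
  rw [← ofReal_norm, ← ofReal_norm, norm_star]

theorem summable_norm_sq_of_hilbertSchmidtSq_ne_top {T : H →L[ℂ] H}
    (h : hilbertSchmidtSq b T ≠ ∞) : Summable fun i => ‖T (b i)‖ ^ 2 := by
  have h1 := ENNReal.summable_toReal h
  simpa using h1

theorem sum_norm_sq_le_hilbertSchmidtSq {T : H →L[ℂ] H} (h : hilbertSchmidtSq b T ≠ ∞)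
    (t : Finset ι) : ∑ i ∈ t, ‖T (b i)‖ ^ 2 ≤ (hilbertSchmidtSq b T).toReal := by
  have h1 : ∑ i ∈ t, ‖T (b i)‖ₑ ^ 2 ≤ hilbertSchmidtSq b T := ENNReal.sum_le_tsum t
  have h2 := ENNReal.toReal_mono h h1
  rw [ENNReal.toReal_sum (fun i _ => by simp)] at h2
  simpa using h2

end HilbertSchmidt

/-! ### Polar decomposition of trace class operators -/

section Polar

variable [CompleteSpace H]

theorem norm_cfcAbs_apply (A : H →L[ℂ] H) (x : H) : ‖CFC.abs A x‖ = ‖A x‖ := by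
  have hs : IsSelfAdjoint (CFC.abs A) := (CFC.abs_nonneg A).isSelfAdjoint
  have h : (⟪CFC.abs A x, CFC.abs A x⟫_ℂ) = ⟪A x, A x⟫_ℂ := by
    rw [← ContinuousLinearMap.adjoint_inner_right, ← ContinuousLinearMap.adjoint_inner_right,
      ← ContinuousLinearMap.star_eq_adjoint, ← ContinuousLinearMap.star_eq_adjoint, hs.star_eq,
      ← mul_apply_eq_comp, ← mul_apply_eq_comp, CFC.abs_mul_abs]
  rw [inner_self_eq_norm_sq_to_K, inner_self_eq_norm_sq_to_K] at h
  exact (sq_eq_sq₀ (norm_nonneg _) (norm_nonneg _)).1 (by exact_mod_cast h)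

/-- If `B` dominates `A` pointwise, then `A = U B`: the map `B x ↦ A x` is well defined and bounded
on the range of `B`, extends to its closure, and is continued by zero on the orthogonal
complement. -/
theorem exists_eq_mul_of_norm_apply_le (A B : H →L[ℂ] H) (h : ∀ x, ‖A x‖ ≤ ‖B x‖) :
    ∃ U : H →L[ℂ] H, A = U * B := by
  let K : Submodule ℂ H := B.range.topologicalClosure
  let e : H →ₗ[ℂ] K := (B : H →ₗ[ℂ] H).codRestrict K fun x =>
    Submodule.le_topologicalClosure _ ⟨x, rfl⟩
  have hd : DenseRange e := by
    intro y
    rw [closure_subtype]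
    have hy : (y : H) ∈ closure (B.range : Set H) := y.2
    convert hy
    ext z
    constructor
    · rintro ⟨_, ⟨x, rfl⟩, rfl⟩
      exact ⟨x, rfl⟩
    · rintro ⟨x, rfl⟩
      exact ⟨e x, ⟨x, rfl⟩, rfl⟩
  have : CompleteSpace K := B.range.isClosed_topologicalClosure.completeSpace_coe
  refine ⟨((A : H →ₗ[ℂ] H).extendOfNorm e).comp K.orthogonalProjectionOnto,
    ContinuousLinearMap.ext fun x => ?_⟩
  have hx : K.orthogonalProjectionOnto (B x) = e x :=
    K.orthogonalProjectionOnto_mem_subspace_eq_self (e x)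
  rw [mul_apply_eq_comp, ContinuousLinearMap.comp_apply, hx,
    LinearMap.extendOfNorm_eq hd ⟨1, fun x => by rw [one_mul]; exact h x⟩]
  rfl

/-- A trace class operator factors as `A = U S S`, with a Hilbert–Schmidt operator `S`: namely
`S = |A|^{1/2}` for a polar decomposition `A = U|A|`. -/
theorem IsTraceClass.exists_factorization {A : H →L[ℂ] H} (hA : IsTraceClass A) :
    ∃ U S : H →L[ℂ] H, A = U * (S * S) ∧ IsSelfAdjoint S ∧
      hilbertSchmidtSq (someHilbertBasis H) S ≠ ∞ := by
  obtain ⟨U, hU⟩ := exists_eq_mul_of_norm_apply_le A (CFC.abs A) fun x =>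
    (norm_cfcAbs_apply A x).ge
  have hS : IsSelfAdjoint (CFC.sqrt (CFC.abs A)) := (CFC.sqrt_nonneg _).isSelfAdjoint
  have hSS := CFC.sqrt_mul_sqrt_self (CFC.abs A) (CFC.abs_nonneg A)
  refine ⟨U, CFC.sqrt (CFC.abs A), by rw [hSS, ← hU], hS, ?_⟩
  set S := CFC.sqrt (CFC.abs A)
  have h1 : ∀ x, RCLike.re ⟪x, CFC.abs A x⟫_ℂ = ‖S x‖ ^ 2 := fun x => by
    rw [← hSS, mul_apply_eq_comp, ← ContinuousLinearMap.adjoint_inner_left,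
      ← ContinuousLinearMap.star_eq_adjoint, hS.star_eq, inner_self_eq_norm_sq]
  have h2 : Summable fun i => ‖S (someHilbertBasis H i)‖ ^ 2 := by
    simpa only [IsTraceClass, h1] using hA
  have h3 : hilbertSchmidtSq (someHilbertBasis H) S =
      ∑' i, ENNReal.ofReal (‖S (someHilbertBasis H i)‖ ^ 2) :=
    tsum_congr fun i => by rw [ENNReal.ofReal_pow (norm_nonneg _), ofReal_norm]
  rw [h3]
  exact h2.tsum_ofReal_ne_top

end Polar

/-! ### Matrix coefficients -/

section MatrixCoeff

variable {V : Type*} [NormedAddCommGroup V] [NormedSpace ℂ V]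

/-- The functional `f ↦ ⟨ξ, ρ(f) η⟩` of a bounded linear family `ρ` of operators. -/
def matrixCoeff (ρ : V →L[ℂ] (H →L[ℂ] H)) (ξ η : H) : NormedDual V :=
  (innerSL ℂ ξ).comp (ρ.flip η)

@[simp] theorem matrixCoeff_apply (ρ : V →L[ℂ] (H →L[ℂ] H)) (ξ η : H) (f : V) :
    matrixCoeff ρ ξ η f = ⟪ξ, ρ f η⟫_ℂ := rfl

theorem matrixCoeff_mem_of_dense (ρ : V →L[ℂ] (H →L[ℂ] H)) {F : Submodule ℂ (NormedDual V)}
    (hF : IsClosed (F : Set (NormedDual V))) {D : Set H} (hD : Dense D)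
    (h : ∀ ξ ∈ D, matrixCoeff ρ ξ ξ ∈ F) (ξ : H) : matrixCoeff ρ ξ ξ ∈ F := by
  have hc : Continuous fun ξ : H => matrixCoeff ρ ξ ξ :=
    (innerSL ℂ (E := H)).continuous.clm_comp ρ.flip.continuous
  exact (hF.preimage hc).closure_subset_iff.2 h (hD ξ)

theorem matrixCoeff_mem_of_diagonal (ρ : V →L[ℂ] (H →L[ℂ] H)) {F : Submodule ℂ (NormedDual V)}
    (h : ∀ ξ, matrixCoeff ρ ξ ξ ∈ F) (ξ η : H) : matrixCoeff ρ ξ η ∈ F := by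
  have key : matrixCoeff ρ ξ η = (4⁻¹ : ℂ) •
      (matrixCoeff ρ (ξ + η) (ξ + η) - matrixCoeff ρ (ξ - η) (ξ - η)
        - Complex.I • matrixCoeff ρ (ξ + Complex.I • η) (ξ + Complex.I • η)
        + Complex.I • matrixCoeff ρ (ξ - Complex.I • η) (ξ - Complex.I • η)) := by
    ext f
    simp only [smul_apply, add_apply,
      sub_apply, matrixCoeff_apply, map_add, map_sub, map_smul,
      inner_add_left, inner_add_right, inner_sub_left, inner_sub_right, inner_smul_left,
      inner_smul_right, smul_eq_mul, Complex.conj_I]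
    ring_nf
    simp only [Complex.I_sq]
    ring
  rw [key]
  exact F.smul_mem _ (F.add_mem (F.sub_mem (F.sub_mem (h _) (h _)) (F.smul_mem _ (h _)))
    (F.smul_mem _ (h _)))

/-- If a closed space of functionals contains all matrix coefficients of `ρ`, then it contains
`f ↦ tr (A ρ(f))` for all operators `A` of trace class. -/
theorem trace_functional_mem (ρ : V →L[ℂ] (H →L[ℂ] H)) {F : Submodule ℂ (NormedDual V)}
    (hF : IsClosed (F : Set (NormedDual V))) (h : ∀ ξ η, matrixCoeff ρ ξ η ∈ F)
    [CompleteSpace H] {A : H →L[ℂ] H} (hA : IsTraceClass A) :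
    ∃ φ ∈ F, ∀ f, φ f = opTrace (A * ρ f) := by
  obtain ⟨U, S, hUS, hS, hS2⟩ := hA.exists_factorization
  set b := someHilbertBasis H
  let X : H →L[ℂ] H := S * star U
  have hX : hilbertSchmidtSq b X ≠ ∞ :=
    ne_top_of_le_ne_top (ENNReal.mul_ne_top (by simp) hS2) (hilbertSchmidtSq_mul_le_right b _ _)
  set K : ℝ := (hilbertSchmidtSq b S).toReal
  have hY : ∀ (f : V) (t : Finset _), ∑ i ∈ t, ‖(S * ρ f) (b i)‖ ^ 2 ≤ (‖ρ‖ * ‖f‖) ^ 2 * K := by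
    intro f t
    have h1 := hilbertSchmidtSq_mul_le_right b S (ρ f)
    have h2 := ENNReal.mul_ne_top (a := ‖ρ f‖ₑ ^ 2) (by simp) hS2
    refine (sum_norm_sq_le_hilbertSchmidtSq b (ne_top_of_le_ne_top h2 h1) t).trans ?_
    refine (ENNReal.toReal_mono h2 h1).trans ?_
    rw [ENNReal.toReal_mul, ENNReal.toReal_pow, toReal_enorm]
    gcongr
    exact ρ.le_opNorm f
  have hterm : ∀ i f, matrixCoeff ρ (star A (b i)) (b i) f = ⟪X (b i), (S * ρ f) (b i)⟫_ℂ := by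
    intro i f
    have h1 : star A (b i) = S (X (b i)) := by
      rw [hUS, star_mul, star_mul, hS.star_eq]
      rfl
    rw [matrixCoeff_apply, h1, ← ContinuousLinearMap.adjoint_inner_right,
      ← ContinuousLinearMap.star_eq_adjoint, hS.star_eq]
    rfl
  have hbound : ∀ t, ‖∑ i ∈ t, matrixCoeff ρ (star A (b i)) (b i)‖
      ≤ √(∑ i ∈ t, ‖X (b i)‖ ^ 2) * (‖ρ‖ * √K) := by
    intro t
    refine ContinuousLinearMap.opNorm_le_bound _ (by positivity) fun f => ?_
    rw [sum_apply]
    calc ‖∑ i ∈ t, matrixCoeff ρ (star A (b i)) (b i) f‖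
        ≤ ∑ i ∈ t, ‖X (b i)‖ * ‖(S * ρ f) (b i)‖ :=
          norm_sum_le_of_le _ fun i _ => by
            rw [hterm]
            exact norm_inner_le_norm _ _
      _ ≤ √(∑ i ∈ t, ‖X (b i)‖ ^ 2) * √(∑ i ∈ t, ‖(S * ρ f) (b i)‖ ^ 2) :=
          Real.sum_mul_le_sqrt_mul_sqrt _ _ _
      _ ≤ √(∑ i ∈ t, ‖X (b i)‖ ^ 2) * √((‖ρ‖ * ‖f‖) ^ 2 * K) := by
          gcongr
          exact hY f t
      _ = _ := by
          rw [Real.sqrt_mul (by positivity), Real.sqrt_sq (by positivity)]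
          ring
  have hsum : Summable fun i => matrixCoeff ρ (star A (b i)) (b i) := by
    rw [summable_iff_vanishing_norm]
    intro ε hε
    -- The factor `‖ρ‖ √K` of the bound may vanish, hence the `+ 1`.
    set M := ‖ρ‖ * √K + 1
    have hM : 0 < M := by positivity
    obtain ⟨s, hs⟩ := summable_iff_vanishing_norm.1
      (summable_norm_sq_of_hilbertSchmidtSq_ne_top b hX) ((ε / M) ^ 2) (by positivity)
    refine ⟨s, fun t ht => (hbound t).trans_lt ?_⟩
    have h1 : √(∑ i ∈ t, ‖X (b i)‖ ^ 2) < ε / M :=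
      (Real.sqrt_lt' (by positivity)).2 ((le_abs_self _).trans_lt (hs t ht))
    calc √(∑ i ∈ t, ‖X (b i)‖ ^ 2) * (‖ρ‖ * √K)
        ≤ √(∑ i ∈ t, ‖X (b i)‖ ^ 2) * M := by
          gcongr
          exact (lt_add_one _).le
      _ < ε / M * M := by gcongr
      _ = ε := div_mul_cancel₀ _ hM.ne'
  refine ⟨∑' i, matrixCoeff ρ (star A (b i)) (b i),
    hF.mem_of_tendsto hsum.hasSum (.of_forall fun t => F.sum_mem fun i _ => h _ _), fun f => ?_⟩
  rw [← ContinuousLinearMap.apply_apply f, ContinuousLinearMap.map_tsum _ hsum]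
  refine tsum_congr fun i => ?_
  rw [ContinuousLinearMap.apply_apply, matrixCoeff_apply, ContinuousLinearMap.star_eq_adjoint,
    ContinuousLinearMap.adjoint_inner_left]
  rfl

end MatrixCoeff

/-! ### Rank one operators -/

open InnerProductSpace in
theorem isTraceClass_rankOne_self [CompleteSpace H] (ξ : H) : IsTraceClass (rankOne ℂ ξ ξ) := by
  have h : 0 ≤ rankOne ℂ ξ ξ :=
    (ContinuousLinearMap.nonneg_iff_isPositive _).2 (isPositive_rankOne_self ξ)
  unfold IsTraceClass
  rw [CFC.abs_of_nonneg _ h]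
  convert! Complex.reCLM.summable ((someHilbertBasis H).summable_inner_mul_inner ξ ξ) using 2
  simp

open InnerProductSpace in
theorem opTrace_rankOne_self_mul [CompleteSpace H] (ξ : H) (T : H →L[ℂ] H) :
    opTrace (rankOne ℂ ξ ξ * T) = ⟪ξ, T ξ⟫_ℂ := by
  rw [← ContinuousLinearMap.adjoint_inner_left, ← (someHilbertBasis H).tsum_inner_mul_inner]
  refine tsum_congr fun i => ?_
  simp [ContinuousLinearMap.adjoint_inner_left]

end Operators

/-! ### Weak continuity of a representation -/

theorem propositionB8 (Ω : TopologicalSpace.Opens ℂ) (hΩ : IsSimplyConnected (Ω : Set ℂ))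
    (hΩ' : (Ω : Set ℂ) ≠ Set.univ) (σ : AntiholomorphicInvolution Ω)
    (F : Submodule ℂ (NormedDual (HInfty σ))) (hF : IsPredual F)
    {H : Type*} [NormedAddCommGroup H] [InnerProductSpace ℂ H] [CompleteSpace H]
    (π : HInfty σ →⋆ₙₐ[ℂ] (H →L[ℂ] H)) :
    List.TFAE
      [∀ A : H →L[ℂ] H, IsTraceClass A → WeaklyContinuous F (fun f => opTrace (A * π f)),
        ∀ ξ : H, WeaklyContinuous F (fun f => inner ℂ ξ (π f ξ)),
        ∃ D : Submodule ℂ H, Dense (D : Set H) ∧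
          ∀ ξ ∈ D, WeaklyContinuous F (fun f => inner ℂ ξ (π f ξ))] := by
  have : Nonempty Ω := hΩ.nonempty.to_subtype
  have hπ : ∀ f, ‖π f‖ ≤ 1 * ‖f‖ := fun f => by
    rw [one_mul]
    exact norm_starHom_apply_le π f
  let ρ : HInfty σ →L[ℂ] (H →L[ℂ] H) :=
    LinearMap.mkContinuous (π : HInfty σ →ₗ[ℂ] (H →L[ℂ] H)) 1 hπ
  have hcoeff : ∀ ξ, WeaklyContinuous F (fun f => inner ℂ ξ (π f ξ)) ↔ matrixCoeff ρ ξ ξ ∈ F :=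
    fun ξ => weaklyContinuous_iff_mem F (matrixCoeff ρ ξ ξ)
  simp only [hcoeff]
  tfae_have 1 → 2 := fun h ξ => by
    rw [← hcoeff]
    simpa only [opTrace_rankOne_self_mul] using h _ (isTraceClass_rankOne_self ξ)
  tfae_have 2 → 3 := fun h => ⟨⊤, by simp, fun ξ _ => h ξ⟩
  tfae_have 3 → 2 := fun ⟨D, hD, h⟩ => matrixCoeff_mem_of_dense ρ hF.isClosed hD h
  tfae_have 2 → 1 := fun h A hA => by
    obtain ⟨φ, hφ, hφA⟩ :=
      trace_functional_mem ρ hF.isClosed (matrixCoeff_mem_of_diagonal ρ h) hA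
    have h1 : (fun f => opTrace (A * π f)) = φ := funext fun f => (hφA f).symm
    rw [h1]
    exact (weaklyContinuous_iff_mem F φ).2 hφ
  tfae_finish

end
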